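/- **Setting.** Let $M>1$, let $n\ge 1$ be an integer, and let $v\ge 0$ satisfy $(n-1)Mv\le (M-1)n$ (that is, $v\in[0,\frac{(M-1)n}{(n-1)M}]$, the right end point being $+\infty$ for $n=1$). Let $(\alpha,\beta)$ be the stepsize schedule with parameters $(M,n,v)$, i.e. $\alpha\in[\frac1M,1)$, $\beta\in(\frac{\alpha}{M},\frac{M+1}{2M})$, $$0=(M-1)Mn\alpha^3-(M+1)(M-2)n\alpha^2-(4n+(M-1)(n-1)v)\alpha+2n,$$ and, writing $w=-n+(n-1)v$, $$\begin{aligned}0=\ &Mn\big((M-1)^2n+(M+1)^2(n-1)v\big)\big((M-1)\alpha+M+1\big)\beta^2\\ &+2M\Big[2(M-1)Mnw\,\alpha^2+(1+M)w\big((3-M)n+(M-1)(n-1)v\big)\alpha\\ &\qquad\quad+n\big(n-(M-4)Mn-(1+M)(3+M)(n-1)v\big)\Big]\beta\\ &+\Big[-2M(M^2-1)nw\,\alpha^2+\big(2(2+M+2M^2-M^3)n^2+(M-3)(1+M)^2(n-1)nv\\ &\qquad\quad+(1-M)(1+M)^2(n-1)^2v^2\big)\alpha+2(1+M)^2nw\Big].\end{aligned}$$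 **Dual problem.** Let $\Omega=\{0,1^{(1)},\dots,1^{(n)},*\}$. Write the standard basis of $\mathbb R^{1+n+n^2}$ as $\bar x_0$, $\bar g_0^{(i)}$, $\bar g_{1^{(i)}}^{(j)}$ ($i,j\in[n]$) and put $\bar x_{1^{(i)}}=\bar x_0-\alpha\bar g_0^{(i)}$, $\bar x_*=0$, $\bar f'_0=\frac1n\sum_t\bar g_0^{(t)}$, $\bar f'_{1^{(i)}}=\frac1n\sum_t\bar g_{1^{(i)}}^{(t)}$, $\bar f'_*=0$. Let $$\bar A_R=\bar x_0\bar x_0^\top,\qquad \bar A_0=\tfrac1n\sum_i(\bar g_0^{(i)}-\bar f'_0)(\bar g_0^{(i)}-\bar f'_0)^\top,\qquad \bar A_i=\tfrac1n\sum_j(\bar g_{1^{(i)}}^{(j)}-\bar f'_{1^{(i)}})(\bar g_{1^{(i)}}^{(j)}-\bar f'_{1^{(i)}})^\top,$$ $$\bar C=\tfrac1{n^2}\sum_{i,j}(\bar x_0-\alpha\bar g_0^{(i)}-\beta\bar g_{1^{(i)}}^{(j)})(\bar x_0-\alpha\bar g_0^{(i)}-\beta\bar g_{1^{(i)}}^{(j)})^\top,$$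 $$\bar B_{i,j}=V\begin{bmatrix}-M&M&1&-M\\M&-M&-1&M\\1&-1&-1&1\\-M&M&1&-1\end{bmatrix}V^\top,\qquad V=[\bar x_i\ \bar x_j\ \bar f'_i\ \bar f'_j].$$ The dual semidefinite program of the two-step performance estimation problem minimizes $\tau R^2+\sum_{i=0}^n\mu_i\sigma^2$ over real $\tau\ge0$, $\mu_i\ge 0$ ($0\le i\le n$), $\lambda_{i,j}\ge0$ ($i\ne j$ in $\Omega$) subject to $$\Delta:=\tau\bar A_R+\sum_{i=0}^n\mu_i\bar A_i-\sum_{i\ne j}\lambda_{i,j}\bar B_{i,j}-\bar C\succeq0\quad\text{and}\quad\sum_{i\ne j}\lambda_{i,j}=\sum_{i\ne j}\lambda_{j,i}\ \ \text{for all } j\in\Omega .$$ **Multipliers.** For $k\in[n]$ and $l\in[n]$, $l\neq k$, put $$\lambda_{1^{(k)},*}=a:=\frac{\alpha+\beta-\alpha\beta}{n(1+M-\alpha+M\alpha)},\qquad \lambda_{*,1^{(k)}}=b:=\frac{M\beta+\alpha(-1+M\beta)}{Mn(1+M-\alpha+M\alpha)},$$ $$\lambda_{0,*}=0,\qquad \lambda_{*,0}=n(a-b),\qquad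 \lambda_{1^{(k)},1^{(l)}}=0,$$ $$\lambda_{0,1^{(k)}}=p:=\frac{n^2(a+Mb)^2-n(a+b)}{2(n-nv+v)}+\frac{a-b}2,\qquad \lambda_{1^{(k)},0}=q:=\frac{n^2(a+Mb)^2-n(a+b)}{2(n-nv+v)}-\frac{a-b}2,$$ $$\tau=1-M(\lambda_{0,*}+\lambda_{*,0}+na+nb).$$ If $n=1$, put $\mu_0=\mu_1=0$. If $n>1$, put $$\mu_0=\max\Big\{0,\tfrac{n^2-(n-1)^2v^2}{(n-1)v}(p+q)+n(p+q)-2\alpha n(p+Mq)+\lambda_{0,*}+\lambda_{*,0}\Big\},$$ $$\mu_i=\max\Big\{0,\big(1-\tfrac{(n-1)v}{n}\big)(p+q)+a+b\Big\}\quad(i\in[n]),$$ where $\mu_0=+\infty$ if $v=0$. **Theorem.** (i) $\tau\ge 0$, $\mu_i\ge0$ for $0\le i\le n$, and $\lambda_{i,j}\ge0$ for all $i\ne j$ in $\Omega$. (ii) The equality constraints of the dual problem hold and, if $n=1$ or $v>0$, the matrix $\Delta$ (of size $1+n+n^2$) is positive semidefinite. (iii) Suppose $n=1$ or $v>0$.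 Let $R,\sigma>0$, $d\in\mathbb N$, and let $f:\mathbb R^d\to\mathbb R$ be differentiable and $1$-strongly convex with $M$-Lipschitz gradient. Let $g(x,\xi)$ be a stochastic gradient such that, at every $x\in\mathbb R^d$, $g(x,\xi)$ takes $n$ values (listed with multiplicity) with probability $1/n$ each, $\mathbb E_\xi[g(x,\xi)]=\nabla f(x)$ and $\mathbb E_\xi\|g(x,\xi)-\nabla f(x)\|^2\le\sigma^2$. Let $\nabla f(x_*)=0$, $\|x_0-x_*\|^2\le R^2$, and let $x_1=x_0-\alpha g(x_0,\xi_0)$, $x_2=x_1-\beta g(x_1,\xi_1)$ with $\xi_0,\xi_1$ independent copies of $\xi$. Then $$\mathbb E_{\xi_0,\xi_1}\|x_2-x_*\|^2\le\tau R^2+\sum_{i=0}^n\mu_i\sigma^2 .$$ -/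

import Mathlib

open MeasureTheory ProbabilityTheory
open scoped ENNReal

noncomputable section

namespace TwoStepSG

/-! ### Functions, stochastic oracle and the two-step stochastic gradient method -/

/-- `f : ℝᵈ → ℝ` is differentiable, `m`-strongly convex, with `M`-Lipschitz gradient. -/
structure StronglyConvexSmooth {d : ℕ} (m M : ℝ) (f : EuclideanSpace ℝ (Fin d) → ℝ) : Prop where
  differentiable : Differentiable ℝ f
  strong_convexity : ∀ x y,
    f x + inner ℝ (gradient f x) (y - x) + m / 2 * ‖y - x‖ ^ 2 ≤ f y
  lipschitz_gradient : ∀ x y, ‖gradient f x - gradient f y‖ ≤ M * ‖x - y‖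

/-- `g(x, ξ)`, with `ξ` of law `P`, is a stochastic gradient of `f`: at every point `x` it takes
`n` values (listed with multiplicity) with probability `1 / n` each, it is unbiased, and its
variance is at most `σ ^ 2`. -/
structure IsStochasticGradient {d : ℕ} {Ξ : Type*} [MeasurableSpace Ξ] (P : Measure Ξ)
    (f : EuclideanSpace ℝ (Fin d) → ℝ)
    (g : EuclideanSpace ℝ (Fin d) → Ξ → EuclideanSpace ℝ (Fin d)) (n : ℕ) (σ : ℝ) : Prop where
  measurable : ∀ x, Measurable (g x)
  equiprobable : ∀ x, ∃ γ : Fin n → EuclideanSpace ℝ (Fin d),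
    P.map (g x) = (n : ℝ≥0∞)⁻¹ • ∑ i, Measure.dirac (γ i)
  unbiased : ∀ x, ∫ ξ, g x ξ ∂P = gradient f x
  variance_le : ∀ x, ∫ ξ, ‖g x ξ - gradient f x‖ ^ 2 ∂P ≤ σ ^ 2

/-- One stochastic gradient step from `x` with stepsize `a` and sample `ξ`. -/
def sgStep {d : ℕ} {Ξ : Type*} (g : EuclideanSpace ℝ (Fin d) → Ξ → EuclideanSpace ℝ (Fin d))
    (a : ℝ) (x : EuclideanSpace ℝ (Fin d)) (ξ : Ξ) : EuclideanSpace ℝ (Fin d) :=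
  x - a • g x ξ

/-! ### The stepsize schedule -/

/-- `(α, β)` is the two-step stepsize schedule with parameters `(M, n, v)`. -/
structure IsSchedule (M : ℝ) (n : ℕ) (v α β : ℝ) : Prop where
  alpha_ge : 1 / M ≤ α
  alpha_lt : α < 1
  beta_gt : α / M < β
  beta_lt : β < (M + 1) / (2 * M)
  alpha_eq : 0 = (M - 1) * M * n * α ^ 3 - (M + 1) * (M - 2) * n * α ^ 2
    - (4 * n + (M - 1) * (n - 1) * v) * α + 2 * n
  beta_eq : 0 =
    M * n * ((-1 + M) ^ 2 * n + (1 + M) ^ 2 * (-1 + n) * v) * ((-1 + M) * α + (1 + M)) * β ^ 2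
    + 2 * M * (2 * (-1 + M) * M * n * (-n + (n - 1) * v) * α ^ 2
        + (1 + M) * (-n + (n - 1) * v) * ((3 - M) * n + (-1 + M) * (-1 + n) * v) * α
        + n * (n - (M - 4) * M * n - (1 + M) * (3 + M) * (-1 + n) * v)) * β
    + (-2 * M * (-1 + M ^ 2) * n * (-n + (n - 1) * v) * α ^ 2
        + (2 * (2 + M + 2 * M ^ 2 - M ^ 3) * n ^ 2
            + (-3 + M) * (1 + M) ^ 2 * (-1 + n) * n * v
            + (1 - M) * (1 + M) ^ 2 * (-1 + n) ^ 2 * v ^ 2) * α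
        + 2 * (1 + M) ^ 2 * n * (-n + (n - 1) * v))

/-! ### The data of the dual semidefinite program -/

/-- The index set `Ω = {0, 1⁽¹⁾, …, 1⁽ⁿ⁾, *}`. -/
inductive Idx (n : ℕ) : Type
  | zero : Idx n
  | one (i : Fin n) : Idx n
  | star : Idx n
  deriving DecidableEq, Fintype

/-- The `1 + n + n²` coordinates: `x₀`, the `n` stochastic gradients at `x₀`, and the `n`
stochastic gradients at each of the `n` points `x_{1⁽ⁱ⁾}`. -/
inductive Coord (n : ℕ) : Type
  | x0 : Coord n
  | g0 (i : Fin n) : Coord n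
  | g1 (i j : Fin n) : Coord n
  deriving DecidableEq, Fintype

variable {n : ℕ}

/-- The symbolic vector of `x₀`. -/
def vx0 : Coord n → ℝ := Pi.single Coord.x0 1

/-- The symbolic vector of the `i`-th stochastic gradient at `x₀`. -/
def vg0 (i : Fin n) : Coord n → ℝ := Pi.single (Coord.g0 i) 1

/-- The symbolic vector of the `j`-th stochastic gradient at `x_{1⁽ⁱ⁾}`. -/
def vg1 (i j : Fin n) : Coord n → ℝ := Pi.single (Coord.g1 i j) 1

/-- The symbolic vectors of the points `x_i`, `i ∈ Ω`. -/
def vx (α : ℝ) : Idx n → Coord n → ℝ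
  | Idx.zero => vx0
  | Idx.one i => vx0 - α • vg0 i
  | Idx.star => 0

/-- The symbolic vectors of the gradients `∇f(x_i)`, `i ∈ Ω`. -/
def vgrad : Idx n → Coord n → ℝ
  | Idx.zero => (1 / (n : ℝ)) • ∑ t, vg0 t
  | Idx.one i => (1 / (n : ℝ)) • ∑ t, vg1 i t
  | Idx.star => 0

/-- The outer product `u uᵀ`. -/
def outer (u : Coord n → ℝ) : Matrix (Coord n) (Coord n) ℝ := Matrix.vecMulVec u u

/-- The matrix of the initial distance `‖x₀ - x_*‖²`. -/
def matR (n : ℕ) : Matrix (Coord n) (Coord n) ℝ := outer vx0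

/-- The matrix of the variance at `x₀` (`none`) and at `x_{1⁽ⁱ⁾}` (`some i`). -/
def matVar : Option (Fin n) → Matrix (Coord n) (Coord n) ℝ
  | none => (1 / (n : ℝ)) • ∑ i, outer (vg0 i - vgrad Idx.zero)
  | some i => (1 / (n : ℝ)) • ∑ j, outer (vg1 i j - vgrad (Idx.one i))

/-- The matrix of the interpolation condition for `m`-strongly convex, `M`-smooth functions
between the points with index `i` and `j`. -/
def matB (m M α : ℝ) (i j : Idx n) : Matrix (Coord n) (Coord n) ℝ :=
  let V : Matrix (Coord n) (Fin 4) ℝ :=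
    (Matrix.of ![vx α i, vx α j, vgrad i, vgrad j]).transpose
  V * !![-(M * m), M * m, m, -M;
         M * m, -(M * m), -m, M;
         m, -m, -1, 1;
         -M, M, 1, -1] * V.transpose

/-- The matrix of the objective `E ‖x₂ - x_*‖²`. -/
def matC (n : ℕ) (α β : ℝ) : Matrix (Coord n) (Coord n) ℝ :=
  (1 / (n : ℝ) ^ 2) • ∑ i, ∑ j, outer (vx0 - α • vg0 i - β • vg1 i j)

/-- The matrix that the dual semidefinite program requires to be positive semidefinite. -/
def matDual (m M α β τ : ℝ) (μ : Option (Fin n) → ℝ) (lam : Idx n → Idx n → ℝ) :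
    Matrix (Coord n) (Coord n) ℝ :=
  τ • matR n + ∑ k, μ k • matVar k
    - ∑ p ∈ (Finset.univ : Finset (Idx n)).offDiag, lam p.1 p.2 • matB m M α p.1 p.2
    - matC n α β

/-! ### The explicit multipliers -/

/-- The common value of `λ_{1⁽ⁱ⁾,*}`. -/
def lamOneStar (M : ℝ) (n : ℕ) (α β : ℝ) : ℝ :=
  (α + β - α * β) / (n * (1 + M - α + M * α))

/-- The common value of `λ_{*,1⁽ⁱ⁾}`. -/
def lamStarOne (M : ℝ) (n : ℕ) (α β : ℝ) : ℝ :=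
  (M * β + α * (-1 + M * β)) / (M * n * (1 + M - α + M * α))

/-- The common value of `λ_{0,1⁽ⁱ⁾}`. -/
def lamZeroOne (M : ℝ) (n : ℕ) (v α β : ℝ) : ℝ :=
  (n ^ 2 * (lamOneStar M n α β + M * lamStarOne M n α β) ^ 2
      - n * (lamOneStar M n α β + lamStarOne M n α β)) / (2 * (n - n * v + v))
    + (lamOneStar M n α β - lamStarOne M n α β) / 2

/-- The common value of `λ_{1⁽ⁱ⁾,0}`. -/
def lamOneZero (M : ℝ) (n : ℕ) (v α β : ℝ) : ℝ :=
  (n ^ 2 * (lamOneStar M n α β + M * lamStarOne M n α β) ^ 2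
      - n * (lamOneStar M n α β + lamStarOne M n α β)) / (2 * (n - n * v + v))
    - (lamOneStar M n α β - lamStarOne M n α β) / 2

/-- The multipliers `λ_{i,j}`; only those with `i ≠ j` are variables of the dual problem. -/
def lamMul (M : ℝ) (n : ℕ) (v α β : ℝ) : Idx n → Idx n → ℝ
  | Idx.one _, Idx.star => lamOneStar M n α β
  | Idx.star, Idx.one _ => lamStarOne M n α β
  | Idx.zero, Idx.star => 0
  | Idx.star, Idx.zero => n * (lamOneStar M n α β - lamStarOne M n α β)
  | Idx.zero, Idx.one _ => lamZeroOne M n v α β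
  | Idx.one _, Idx.zero => lamOneZero M n v α β
  | Idx.one _, Idx.one _ => 0
  | Idx.zero, Idx.zero => 0
  | Idx.star, Idx.star => 0

/-- The multiplier `τ`. -/
def tauMul (M : ℝ) (n : ℕ) (v α β : ℝ) : ℝ :=
  1 - M * (lamMul M n v α β Idx.zero Idx.star + lamMul M n v α β Idx.star Idx.zero
    + ∑ i : Fin n, lamMul M n v α β (Idx.one i) Idx.star
    + ∑ i : Fin n, lamMul M n v α β Idx.star (Idx.one i))

/-- The multipliers `μ₀` (`none`) and `μ_i` (`some i`). For `n > 1` and `v = 0` the value of `μ₀`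
is `+∞` in the usual convention; the real number given here is then without meaning. -/
def muMul (M : ℝ) (n : ℕ) (v α β : ℝ) : Option (Fin n) → ℝ
  | none =>
    if n = 1 then 0 else
      max 0 (((n : ℝ) ^ 2 - ((n : ℝ) - 1) ^ 2 * v ^ 2) / (((n : ℝ) - 1) * v)
          * (lamZeroOne M n v α β + lamOneZero M n v α β)
        + n * (lamZeroOne M n v α β + lamOneZero M n v α β)
        - 2 * α * n * (lamZeroOne M n v α β + M * lamOneZero M n v α β)
        + (lamMul M n v α β Idx.zero Idx.star + lamMul M n v α β Idx.star Idx.zero))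
  | some _ =>
    if n = 1 then 0 else
      max 0 ((1 - ((n : ℝ) - 1) * v / n) * (lamZeroOne M n v α β + lamOneZero M n v α β)
        + (lamStarOne M n α β + lamOneStar M n α β))

end TwoStepSG

end

open TwoStepSG

/-! The argument is weak duality for a semidefinite relaxation, with an explicit certificate. Every
quantity in the analysis is the pairing of a data matrix with the Gram matrix of $x_0-x_*$ and all
the stochastic gradients (`gramForm`). Pairing $\Delta\succeq0$ with it bounds the mean squared
distance by the $\tau$ and $\mu$ terms minus a weighted sum of interpolation expressions. Each
expression is at least a constant multiple of a difference of function values. Since the weights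
$\lambda$ conserve flow on $\Omega$, these differences telescope to zero, and nonnegative
multipliers finish the bound.

The real work is $\Delta\succeq0$. The $n$ gradients at $x_0$ are split into their mean $g$ and
deviations $h_i$, and those at $x_{1^{(i)}}$ into their mean $y_i$ and a variance. For each $i$, the
identities collected in `DualRelations` cancel the $x^2$, $xg$, $xy$ and $gy$ terms
(`DualRelations.reduced_form`). The terms $h_ix$ and $h_ig$ vanish after summation because
$\sum_ih_i=0$. What is left is a nonnegative multiple of $g^2$, a form in $(h_i,y_i)$ which $\mu_0$
makes at least a perfect square, and variances with coefficients made nonnegative by $\mu_i$.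

The schedule enters only through `IsSchedule.dualRelations`: its two polynomial equations make the
cancellations consistent, and its bounds on $\alpha,\beta$ give the signs. -/

namespace TwoStepSG

/-! ### Algebra of the stepsize schedule and the multipliers -/

section Multipliers

/-- The schedule puts the first stepsize below the optimal constant stepsize `2 / (M + 1)`. -/
lemma IsSchedule.alpha_lt_two_div {M : ℝ} {n : ℕ} {v α β : ℝ} (h : IsSchedule M n v α β)
    (hM : 1 < M) (hn : 1 ≤ n) (hv0 : 0 ≤ v) : 0 < 2 - α * (M + 1) := by
  by_contra hc
  have hN : (1 : ℝ) ≤ n := by exact_mod_cast hn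
  have hα : 0 < α := lt_of_lt_of_le (by positivity) h.alpha_ge
  have key := h.alpha_eq
  -- The part of the cubic free of $v$ has the root $\alpha=1$; the remaining quadratic factor must
  -- be nonpositive.
  have e : (n : ℝ) * ((1 - α) * ((M ^ 2 - M) * α ^ 2 + 2 * α - 2))
      = -((M - 1) * ((n - 1) * v) * α) := by linear_combination key
  have h1 : 0 ≤ (M - 1) * ((n - 1) * v) * α := by
    have : 0 ≤ ((n : ℝ) - 1) * v := mul_nonneg (by linarith) hv0
    have : 0 ≤ M - 1 := by linarith
    positivity
  -- At $\alpha=2/(M+1)$ this quadratic equals $2(M-1)^2/(M+1)^2$, and it increases for larger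
  -- $\alpha$.
  have h2 : 0 < (M ^ 2 - M) * α ^ 2 + 2 * α - 2 := by
    have hx : 2 ≤ α * (M + 1) := by linarith
    have h3 : 4 ≤ (α * (M + 1)) ^ 2 := by nlinarith
    have h4 : (M ^ 2 - M) * 4 ≤ (M ^ 2 - M) * (α * (M + 1)) ^ 2 :=
      mul_le_mul_of_nonneg_left h3 (by nlinarith)
    have h5 : (M + 1) * 4 ≤ 2 * α * (M + 1) ^ 2 := by nlinarith
    have h6 : 0 < (M + 1) ^ 2 * ((M ^ 2 - M) * α ^ 2 + 2 * α - 2) := by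
      nlinarith [sq_pos_of_pos (sub_pos.2 hM)]
    exact pos_of_mul_pos_right h6 (by positivity)
  have h3 : 0 < (n : ℝ) * ((1 - α) * ((M ^ 2 - M) * α ^ 2 + 2 * α - 2)) := by
    have := h.alpha_lt
    have : 0 < 1 - α := by linarith
    positivity
  linarith

/-- The relations between the stepsizes and the multipliers `a = λ_{1,*}`, `b = λ_{*,1}`,
`p = λ_{0,1}`, `q = λ_{1,0}` that make the dual matrix positive semidefinite. -/
structure DualRelations (M : ℝ) (n : ℕ) (v α β a b p q : ℝ) : Prop where
  beta : n * (a + M * b) = β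
  alpha : M * n * ((a - b) + α * (a + b)) = α
  sum : (n - (n - 1) * v) * (p + q) = β ^ 2 - n * (a + b)
  diff : p - q = a - b
  cross : α * (M * p + q) = p + q
  grad : n * ((a - b) + (a + b + p + q) * M * α ^ 2 - 2 * α * (p + M * q) + (p + q)) - α ^ 2
    = (n - 1) * v * (p + q)
  a_nonneg : 0 ≤ a
  b_nonneg : 0 ≤ b
  le : b ≤ a
  p_nonneg : 0 ≤ p
  q_nonneg : 0 ≤ q
  two_mul_le : 2 * M * n * a ≤ 1

/-- The multipliers $a,b$ solve the linear system `beta`, `alpha`, while $p,q$ are defined by `sum`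
and `diff`. Only `cross` and `grad` impose conditions on the stepsizes, and these follow from the
two schedule equations. The signs of $\tau$ and $a-b$ come from $\beta<(M+1)/(2M)$, that of $b$ from
$\beta>\alpha/M$, that of $q$ from $\alpha\ge1/M$. -/
lemma IsSchedule.dualRelations {M : ℝ} {n : ℕ} {v α β : ℝ} (h : IsSchedule M n v α β)
    (hM : 1 < M) (hn : 1 ≤ n) (hv0 : 0 ≤ v) (hv : ((n : ℝ) - 1) * M * v ≤ (M - 1) * n) :
    DualRelations M n v α β (lamOneStar M n α β) (lamStarOne M n α β)
      (lamZeroOne M n v α β) (lamOneZero M n v α β) := by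
  have hN : (1 : ℝ) ≤ n := by exact_mod_cast hn
  have hN0 : (0 : ℝ) < n := by linarith
  have hM0 : 0 < M := by linarith
  have hα : 0 < α := lt_of_lt_of_le (by positivity) h.alpha_ge
  have hα1 : α < 1 := h.alpha_lt
  have hMα : 1 ≤ α * M := by
    have := h.alpha_ge
    rwa [div_le_iff₀ hM0] at this
  have hβα : α < β * M := by
    have := h.beta_gt
    rwa [div_lt_iff₀ hM0] at this
  have hβM : β * (2 * M) < M + 1 := by
    have := h.beta_lt
    rwa [lt_div_iff₀ (by positivity)] at this
  have hβ : 0 < β := lt_trans (by positivity) h.beta_gt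
  have h2 := h.alpha_lt_two_div hM hn hv0
  have hD : 0 < 1 + M - α + M * α := by nlinarith
  have hW0 : 0 ≤ ((n : ℝ) - 1) * v := mul_nonneg (by linarith) hv0
  have hW : 0 < (n : ℝ) - (n - 1) * v := by
    have : M * (((n : ℝ) - 1) * v) < M * n := by nlinarith
    linarith [lt_of_mul_lt_mul_left this hM0.le]
  have ha : lamOneStar M n α β * (n * (1 + M - α + M * α)) = α + β - α * β :=
    div_mul_cancel₀ _ (by positivity)
  have hb : lamStarOne M n α β * (M * n * (1 + M - α + M * α)) = M * β + α * (-1 + M * β) :=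
    div_mul_cancel₀ _ (by positivity)
  have hW' : 0 < 2 * ((n : ℝ) - n * v + v) := by linarith
  have hp : (lamZeroOne M n v α β - (lamOneStar M n α β - lamStarOne M n α β) / 2)
      * (2 * ((n : ℝ) - n * v + v)) =
      n ^ 2 * (lamOneStar M n α β + M * lamStarOne M n α β) ^ 2
      - n * (lamOneStar M n α β + lamStarOne M n α β) := by
    rw [lamZeroOne, add_sub_cancel_right, div_mul_cancel₀ _ hW'.ne']
  have diff : lamZeroOne M n v α β - lamOneZero M n v α β
      = lamOneStar M n α β - lamStarOne M n α β := by
    rw [lamZeroOne, lamOneZero]; ring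
  generalize lamZeroOne M n v α β = p at *
  generalize lamOneZero M n v α β = q at *
  generalize lamOneStar M n α β = a at *
  generalize lamStarOne M n α β = b at *
  have beta : n * (a + M * b) = β := by
    apply mul_right_cancel₀ hD.ne'
    linear_combination ha + hb
  have alpha : M * n * ((a - b) + α * (a + b)) = α := by
    apply mul_right_cancel₀ hD.ne'
    linear_combination (M + M * α) * ha + (-1 + α) * hb
  have sum : ((n : ℝ) - (n - 1) * v) * (p + q) = β ^ 2 - n * (a + b) := by
    rw [← beta]
    linear_combination hp - ((n : ℝ) - (n - 1) * v) * diff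
  have two_mul_le : 2 * M * n * a ≤ 1 := by
    refine le_of_mul_le_mul_right ?_ hD
    have : 2 * M * n * a * (1 + M - α + M * α)
        = 1 * (1 + M - α + M * α) - (1 - α) * (M + 1 - β * (2 * M)) := by
      linear_combination 2 * M * ha
    rw [this]
    linarith [mul_pos (sub_pos.2 hα1) (sub_pos.2 hβM)]
  have a_nonneg : 0 ≤ a := by
    refine nonneg_of_mul_nonneg_left (b := n * (1 + M - α + M * α)) ?_ (by positivity)
    rw [ha]; nlinarith [mul_pos hβ (sub_pos.2 hα1)]
  have b_nonneg : 0 ≤ b := by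
    refine nonneg_of_mul_nonneg_left (b := M * n * (1 + M - α + M * α)) ?_ (by positivity)
    rw [hb]; linarith [mul_pos hα (mul_pos hM0 hβ)]
  have hab : (a - b) * (M * n * (1 + M - α + M * α)) = α * (M + 1 - 2 * M * β) := by
    linear_combination M * ha - hb
  have le : b ≤ a := by
    have : 0 ≤ a - b := by
      refine nonneg_of_mul_nonneg_left (b := M * n * (1 + M - α + M * α)) ?_ (by positivity)
      rw [hab]
      exact mul_nonneg hα.le (by linarith)
    linarith
  -- This is `cross` with $a,b,p,q$ eliminated. Multiplied by the positive factor $K$ in the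
  -- $\beta^2$ coefficient of the schedule, it is a combination of the equations for $\beta$ and
  -- $\alpha$.
  have hE : (n : ℝ) * (M * (1 + M - α + M * α) * β ^ 2 - (2 * M * β + (M - 1) * α))
        * (2 - α * (M + 1))
      - (n - (n - 1) * v) * α ^ 2 * (M - 1) * (M + 1 - 2 * M * β) = 0 := by
    have hK : 0 < (M - 1) ^ 2 * (n : ℝ) + (M + 1) ^ 2 * ((n - 1) * v) := by
      have : 0 < M - 1 := by linarith
      positivity
    apply mul_left_cancel₀ hK.ne'
    rw [mul_zero]
    linear_combination (-(2 - α * (M + 1))) * h.beta_eq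
      + (2 * (n - (n - 1) * v) * (M + 1) * (2 * M * β - (M + 1))) * h.alpha_eq
  -- the relation `cross` in terms of `p + q` and `a - b`
  have hs : (p + q) * (2 - α * (M + 1)) = α * (M - 1) * (a - b) := by
    have hne : ((n : ℝ) - (n - 1) * v) * (M * n * (1 + M - α + M * α)) ≠ 0 := by positivity
    apply mul_right_cancel₀ hne
    have hab' : n * (a + b) * (M * (1 + M - α + M * α)) = 2 * M * β + (M - 1) * α := by
      linear_combination M * ha + hb
    linear_combination (M * n * (1 + M - α + M * α)) * (2 - α * (M + 1)) * sum
      - n * (2 - α * (M + 1)) * hab' + hE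
      - ((n : ℝ) - (n - 1) * v) * α * (M - 1) * hab
  have cross : α * (M * p + q) = p + q := by
    linear_combination (-1 / 2 : ℝ) * hs + (α * (M - 1) / 2) * diff
  have grad : n * ((a - b) + (a + b + p + q) * M * α ^ 2 - 2 * α * (p + M * q) + (p + q)) - α ^ 2
      = (n - 1) * v * (p + q) := by
    apply mul_right_cancel₀ h2.ne'
    linear_combination n * α * (M - 1) * (2 - α * (M + 1)) * diff
      + α * (2 - α * (M + 1)) * alpha
      + (n - (n - 1) * v + n * M * α ^ 2 - n * α * (M + 1)) * hs - (a - b) * h.alpha_eq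
  -- Since $a-b=p-q$, this says $2q\ge0$. By `hs` it reduces to $\alpha(M-1)\ge2-\alpha(M+1)$, that
  -- is, $\alpha M\ge1$.
  have hq : (a - b) ≤ p + q := by
    refine le_of_mul_le_mul_right ?_ h2
    rw [hs]
    have : α * (M - 1) * (a - b) - (a - b) * (2 - α * (M + 1)) = 2 * ((a - b) * (α * M - 1)) := by
      ring
    linarith only [this, mul_nonneg (sub_nonneg.2 le) (sub_nonneg.2 hMα)]
  have q_nonneg : 0 ≤ q := by linarith
  have p_nonneg : 0 ≤ p := by linarith
  exact ⟨beta, alpha, sum, diff, cross, grad, a_nonneg, b_nonneg, le, p_nonneg, q_nonneg,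
    two_mul_le⟩

end Multipliers

/-! ### Pairing the data matrices with a Gram matrix -/

section GramForm

variable {n : ℕ}

lemma sum_idx {A : Type*} [AddCommMonoid A] (F : Idx n → A) :
    ∑ i, F i = F Idx.zero + F Idx.star + ∑ i, F (Idx.one i) := by
  let e : Idx n ≃ Option (Option (Fin n)) :=
    { toFun := fun
        | Idx.zero => none
        | Idx.star => some none
        | Idx.one i => some (some i)
      invFun := fun
        | none => Idx.zero
        | some none => Idx.star
        | some (some i) => Idx.one i
      left_inv := by rintro (_ | _ | _) <;> rfl
      right_inv := by rintro (_ | _ | _) <;> rfl }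
  rw [← e.symm.sum_comp, Fintype.sum_option, Fintype.sum_option, add_assoc]
  rfl

variable {E : Type*} [NormedAddCommGroup E] [InnerProductSpace ℝ E]

/-- The linear combination of the vectors `Z k` with coefficients `u k`. -/
noncomputable def comb (Z : Coord n → E) (u : Coord n → ℝ) : E := Fintype.linearCombination ℝ Z u

variable (Z : Coord n → E)

lemma comb_single (k : Coord n) : comb Z (Pi.single k 1) = Z k := by
  simp [comb]

lemma comb_sub (u w : Coord n → ℝ) : comb Z (u - w) = comb Z u - comb Z w := map_sub _ _ _

lemma comb_smul (c : ℝ) (u : Coord n → ℝ) : comb Z (c • u) = c • comb Z u := map_smul _ _ _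

lemma comb_zero : comb Z 0 = 0 := map_zero _

lemma comb_sum {ι : Type*} (s : Finset ι) (u : ι → Coord n → ℝ) :
    comb Z (∑ i ∈ s, u i) = ∑ i ∈ s, comb Z (u i) := map_sum _ _ _

/-- The trace of the product of a matrix with the Gram matrix of the vectors `Z k`. -/
noncomputable def gramForm : Matrix (Coord n) (Coord n) ℝ →ₗ[ℝ] ℝ where
  toFun A := ∑ k, ∑ l, A k l * inner ℝ (Z k) (Z l)
  map_add' A B := by simp [add_mul, Finset.sum_add_distrib]
  map_smul' c A := by simp [mul_assoc, Finset.mul_sum]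

lemma gramForm_vecMulVec (u w : Coord n → ℝ) :
    gramForm Z (Matrix.vecMulVec u w) = inner ℝ (comb Z u) (comb Z w) := by
  simp only [gramForm, comb, LinearMap.coe_mk, AddHom.coe_mk, Fintype.linearCombination_apply,
    sum_inner, inner_sum, inner_smul_left, inner_smul_right, RCLike.conj_to_real,
    Matrix.vecMulVec_apply, mul_assoc, Finset.mul_sum]
  rw [Finset.sum_comm]
  exact Finset.sum_congr rfl fun k _ => Finset.sum_congr rfl fun l _ => by ring

lemma gramForm_outer (u : Coord n → ℝ) : gramForm Z (outer u) = ‖comb Z u‖ ^ 2 := by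
  rw [outer, gramForm_vecMulVec, real_inner_self_eq_norm_sq]

/-- The expression that is nonnegative up to function values in the interpolation condition. -/
noncomputable def interp (M : ℝ) (dx g h : E) : ℝ :=
  -M * ‖dx‖ ^ 2 + 2 * inner ℝ dx (g - M • h) - ‖g - h‖ ^ 2

lemma matB_eq (M α : ℝ) (i j : Idx n) :
    matB 1 M α i j = -M • outer (vx α i - vx α j)
      + Matrix.vecMulVec (vx α i - vx α j) (vgrad i - M • vgrad j)
      + Matrix.vecMulVec (vgrad i - M • vgrad j) (vx α i - vx α j)
      - outer (vgrad i - vgrad j) := by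
  ext k l
  simp [matB, outer, Matrix.mul_apply, Fin.sum_univ_four, Matrix.vecMulVec_apply]
  ring

lemma gramForm_matB (M α : ℝ) (i j : Idx n) :
    gramForm Z (matB 1 M α i j) = interp M (comb Z (vx α i) - comb Z (vx α j))
      (comb Z (vgrad i)) (comb Z (vgrad j)) := by
  rw [matB_eq, map_sub, map_add, map_add, map_smul, gramForm_outer, gramForm_outer,
    gramForm_vecMulVec, gramForm_vecMulVec, real_inner_comm (comb Z (vx α i - vx α j))]
  simp only [comb_sub, comb_smul, interp, smul_eq_mul]
  ring

lemma comb_vx0 : comb Z vx0 = Z Coord.x0 := comb_single Z _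

lemma comb_vg0 (i : Fin n) : comb Z (vg0 i) = Z (Coord.g0 i) := comb_single Z _

lemma comb_vg1 (i j : Fin n) : comb Z (vg1 i j) = Z (Coord.g1 i j) := comb_single Z _

lemma comb_vgrad_zero : comb Z (vgrad Idx.zero) = (1 / (n : ℝ)) • ∑ t, Z (Coord.g0 t) := by
  simp only [vgrad, comb_smul, comb_sum, comb_vg0]

lemma comb_vgrad_one (i : Fin n) :
    comb Z (vgrad (Idx.one i)) = (1 / (n : ℝ)) • ∑ t, Z (Coord.g1 i t) := by
  simp only [vgrad, comb_smul, comb_sum, comb_vg1]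

lemma comb_vgrad_star : comb Z (vgrad Idx.star) = 0 := comb_zero Z

lemma comb_vx_zero (α : ℝ) : comb Z (vx α Idx.zero) = Z Coord.x0 := comb_vx0 Z

lemma comb_vx_one (α : ℝ) (i : Fin n) :
    comb Z (vx α (Idx.one i)) = Z Coord.x0 - α • Z (Coord.g0 i) := by
  simp only [vx, comb_sub, comb_smul, comb_vx0, comb_vg0]

lemma comb_vx_star (α : ℝ) : comb Z (vx α Idx.star) = 0 := comb_zero Z

/-- The variance of the stochastic gradients at `x₀` (`none`) and at `x_{1⁽ⁱ⁾}` (`some i`). -/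
noncomputable def gramVar : Option (Fin n) → ℝ
  | none => (1 / (n : ℝ)) * ∑ i, ‖Z (Coord.g0 i) - comb Z (vgrad Idx.zero)‖ ^ 2
  | some i => (1 / (n : ℝ)) * ∑ j, ‖Z (Coord.g1 i j) - comb Z (vgrad (Idx.one i))‖ ^ 2

lemma gramForm_matVar (k : Option (Fin n)) : gramForm Z (matVar k) = gramVar Z k := by
  cases k <;>
    simp only [matVar, gramVar, map_smul, map_sum, gramForm_outer, comb_sub, comb_vg0, comb_vg1,
      smul_eq_mul]

/-- This identity serves twice: with real $Z$ it is the quadratic form tested for semidefiniteness,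
with Euclidean $Z$ it is the performance estimate. -/
lemma gramForm_matDual (M α β τ : ℝ) (μ : Option (Fin n) → ℝ) (lam : Idx n → Idx n → ℝ)
    (hlam : ∀ i, lam i i = 0) :
    gramForm Z (matDual 1 M α β τ μ lam) = τ * ‖Z Coord.x0‖ ^ 2 + ∑ k, μ k * gramVar Z k
      - ∑ i, ∑ j, lam i j * interp M (comb Z (vx α i) - comb Z (vx α j))
          (comb Z (vgrad i)) (comb Z (vgrad j))
      - 1 / (n : ℝ) ^ 2 * ∑ i, ∑ j,
          ‖Z Coord.x0 - α • Z (Coord.g0 i) - β • Z (Coord.g1 i j)‖ ^ 2 := by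
  have hoff : ∑ p ∈ (Finset.univ : Finset (Idx n)).offDiag, lam p.1 p.2 • matB 1 M α p.1 p.2
      = ∑ i, ∑ j, lam i j • matB 1 M α i j := by
    rw [← Finset.sum_product', ← Finset.diag_union_offDiag,
      Finset.sum_union (Finset.disjoint_diag_offDiag _), Finset.sum_diag]
    simp [hlam]
  rw [matDual, hoff, map_sub, map_sub, map_add, map_smul, matR, gramForm_outer, comb_vx0, matC,
    map_smul]
  simp only [map_sum, map_smul, gramForm_outer, gramForm_matVar, gramForm_matB, comb_sub,
    comb_smul, comb_vx0, comb_vg0, comb_vg1, smul_eq_mul]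

lemma gramForm_real (A : Matrix (Coord n) (Coord n) ℝ) (z : Coord n → ℝ) :
    gramForm z A = z ⬝ᵥ A.mulVec z := by
  simp only [gramForm, LinearMap.coe_mk, AddHom.coe_mk, dotProduct, Matrix.mulVec,
    Finset.mul_sum]
  refine Finset.sum_congr rfl fun k _ => Finset.sum_congr rfl fun l _ => ?_
  simp
  ring

/-- A Gram matrix in $\mathbb R^d$ is the sum of $d$ rank-one matrices, one per coordinate, so the
pairing is a sum of values of the quadratic form of $A$. -/
lemma gramForm_nonneg {A : Matrix (Coord n) (Coord n) ℝ} (hA : A.PosSemidef) {d : ℕ}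
    (Z : Coord n → EuclideanSpace ℝ (Fin d)) : 0 ≤ gramForm Z A := by
  have h : gramForm Z A = ∑ c, gramForm (fun k => Z k c) A := by
    simp only [gramForm, LinearMap.coe_mk, AddHom.coe_mk, PiLp.inner_apply, Finset.mul_sum]
    rw [Finset.sum_comm (s := Finset.univ (α := Fin d))]
    refine Finset.sum_congr rfl fun k _ => ?_
    rw [Finset.sum_comm]
  rw [h]
  refine Finset.sum_nonneg fun c _ => ?_
  rw [gramForm_real]
  simpa using hA.dotProduct_mulVec_nonneg (fun k => Z k c)

lemma interp_real (M dx g h : ℝ) :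
    interp M dx g h = -M * dx ^ 2 + 2 * (dx * (g - M * h)) - (g - h) ^ 2 := by
  simp [interp, mul_comm]

end GramForm

/-! ### Positive semidefiniteness of the dual matrix -/

section PosSemidef

variable {M : ℝ} {n : ℕ} {v α β : ℝ}

/-- The quadratic form of the dual matrix for one index `i`, in terms of the mean `g` of the
gradients at `x₀`, the deviation `h` of the `i`-th of them, and the mean `y` at `x_{1⁽ⁱ⁾}`. -/
lemma DualRelations.reduced_form {a b p q : ℝ} (R : DualRelations M n v α β a b p q)
    (x g h y : ℝ) :
    (1 - 2 * M * n * a) * x ^ 2 - n * ((a - b) * interp M (0 - x) 0 g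
      + a * interp M (x - α * (g + h)) y 0 + b * interp M (0 - (x - α * (g + h))) 0 y
      + p * interp M (x - (x - α * (g + h))) g y + q * interp M (x - α * (g + h) - x) y g)
      - (x - α * (g + h) - β * y) ^ 2
    = (n - 1) * v * (p + q) * (g ^ 2 + y ^ 2)
      + ((n - 1) * v * (p + q) - n * ((a - b) - 2 * α * (p + M * q) + (p + q))) * h ^ 2
      + 2 * n * (p + q) * (h * y)
      + h * (2 * α * (1 - M * n * (a + b)) * x
        + (2 * α ^ 2 * (n * M * (a + b + p + q) - 1) - 2 * α * n * (p + M * q)) * g) := by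
  simp only [interp_real]
  -- The $x^2$ terms cancel by the choice of $\tau$. `alpha` removes $xg$; `beta` and `cross` remove
  -- $xy$, $gy$ and fix $hy$; `grad` and `sum` fix the coefficients of the squares.
  linear_combination (g ^ 2 + h ^ 2) * R.grad - 2 * x * g * R.alpha
    + (2 * α * y * (g + h) - 2 * x * y) * R.beta + 2 * n * y * (g + h) * R.cross + y ^ 2 * R.sum

lemma sum_sub_mean_eq_zero (hn : 1 ≤ n) (g : Fin n → ℝ) :
    ∑ i, (g i - 1 / (n : ℝ) * ∑ t, g t) = 0 := by
  have hn0 : (n : ℝ) ≠ 0 := by positivity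
  rw [Finset.sum_sub_distrib, Finset.sum_const, Finset.card_univ, Fintype.card_fin, nsmul_eq_mul]
  field_simp
  ring

/-- Bias–variance decomposition: the cross term vanishes because deviations from the mean sum to
zero. -/
lemma mean_sq_sub (hn : 1 ≤ n) (g : Fin n → ℝ) (x β : ℝ) :
    1 / (n : ℝ) * ∑ j, (x - β * g j) ^ 2 = (x - β * (1 / (n : ℝ) * ∑ t, g t)) ^ 2
      + β ^ 2 * (1 / (n : ℝ) * ∑ j, (g j - 1 / (n : ℝ) * ∑ t, g t) ^ 2) := by
  have hn0 : (n : ℝ) ≠ 0 := by positivity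
  have h0 := sum_sub_mean_eq_zero hn g
  generalize 1 / (n : ℝ) * ∑ t, g t = y at *
  have e : ∀ j, (x - β * g j) ^ 2
      = (x - β * y) ^ 2 - 2 * β * (x - β * y) * (g j - y) + β ^ 2 * (g j - y) ^ 2 := by
    intro j; ring
  rw [Finset.sum_congr rfl fun j _ => e j, Finset.sum_add_distrib, Finset.sum_sub_distrib,
    ← Finset.mul_sum, ← Finset.mul_sum, h0, Finset.sum_const, Finset.card_univ, Fintype.card_fin,
    nsmul_eq_mul]
  field_simp
  ring

lemma lamMul_self (i : Idx n) : lamMul M n v α β i i = 0 := by cases i <;> rfl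

lemma tauMul_eq : tauMul M n v α β = 1 - 2 * M * n * lamOneStar M n α β := by
  simp [tauMul, lamMul]
  ring

/-- The deviations of the gradients at `x₀` are compensated by `μ₀`. -/
lemma DualRelations.fluctuation_nonneg (hn : 1 ≤ n) (hv1 : 1 < n → 0 < v)
    (R : DualRelations M n v α β (lamOneStar M n α β) (lamStarOne M n α β)
      (lamZeroOne M n v α β) (lamOneZero M n v α β)) (h y : ℝ) (hh : n = 1 → h = 0) :
    0 ≤ (n - 1) * v * (lamZeroOne M n v α β + lamOneZero M n v α β) * y ^ 2
      + (muMul M n v α β none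
        + ((n - 1) * v * (lamZeroOne M n v α β + lamOneZero M n v α β)
          - n * ((lamOneStar M n α β - lamStarOne M n α β)
            - 2 * α * (lamZeroOne M n v α β + M * lamOneZero M n v α β)
            + (lamZeroOne M n v α β + lamOneZero M n v α β)))) * h ^ 2
      + 2 * n * (lamZeroOne M n v α β + lamOneZero M n v α β) * (h * y) := by
  have hs : 0 ≤ lamZeroOne M n v α β + lamOneZero M n v α β := add_nonneg R.p_nonneg R.q_nonneg
  rcases hn.eq_or_lt with rfl | hn1
  · simp [hh rfl]
  have hN : (1 : ℝ) < n := by exact_mod_cast hn1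
  have hW : 0 < ((n : ℝ) - 1) * v := mul_pos (by linarith) (hv1 hn1)
  have hμ := le_max_right 0 (((n : ℝ) ^ 2 - ((n : ℝ) - 1) ^ 2 * v ^ 2) / (((n : ℝ) - 1) * v)
          * (lamZeroOne M n v α β + lamOneZero M n v α β)
        + n * (lamZeroOne M n v α β + lamOneZero M n v α β)
        - 2 * α * n * (lamZeroOne M n v α β + M * lamOneZero M n v α β)
        + (lamMul M n v α β Idx.zero Idx.star + lamMul M n v α β Idx.star Idx.zero))
  have hμ0 : muMul M n v α β none = _ := if_neg hn1.ne'
  rw [← hμ0] at hμ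
  simp only [lamMul] at hμ
  have hdiv : ((n : ℝ) ^ 2 - ((n : ℝ) - 1) ^ 2 * v ^ 2) / (((n : ℝ) - 1) * v)
      = n ^ 2 / (((n : ℝ) - 1) * v) - (n - 1) * v := by
    field_simp
  rw [hdiv] at hμ
  generalize lamZeroOne M n v α β + lamOneZero M n v α β = s at *
  -- With $W=(n-1)v$, the definition of $\mu_0$ makes the coefficient of $h^2$ at least $n^2s/W$,
  -- exactly what completes the square $sW(y+\frac nWh)^2$. The division by $W$ is why $v>0$ is
  -- needed for $n>1$.
  have key : n ^ 2 / (((n : ℝ) - 1) * v) * s ≤ muMul M n v α β none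
        + ((n - 1) * v * s - n * ((lamOneStar M n α β - lamStarOne M n α β)
            - 2 * α * (lamZeroOne M n v α β + M * lamOneZero M n v α β) + s)) := by
    linarith
  generalize ((n : ℝ) - 1) * v = W at *
  have hW0 := hW.ne'
  have hsq : 0 ≤ s * W * (y + n / W * h) ^ 2 := by positivity
  have e : s * W * (y + n / W * h) ^ 2
      = W * s * y ^ 2 + n ^ 2 / W * s * h ^ 2
        + 2 * n * s * (h * y) := by
    field_simp
    ring
  rw [e] at hsq
  linarith [mul_le_mul_of_nonneg_right key (sq_nonneg h)]

/-- The deviations of the gradients at `x_{1⁽ⁱ⁾}` are compensated by `μ_i`. -/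
lemma DualRelations.sq_le_muMul (hn : 1 < n)
    (R : DualRelations M n v α β (lamOneStar M n α β) (lamStarOne M n α β)
      (lamZeroOne M n v α β) (lamOneZero M n v α β)) (i : Fin n) :
    β ^ 2 ≤ n * muMul M n v α β (some i) := by
  have hμ0 : muMul M n v α β (some i) = _ := if_neg hn.ne'
  have hn0 : (0 : ℝ) < n := by positivity
  have hμ := mul_le_mul_of_nonneg_left (le_max_right 0
    ((1 - ((n : ℝ) - 1) * v / n) * (lamZeroOne M n v α β + lamOneZero M n v α β)
        + (lamStarOne M n α β + lamOneStar M n α β))) hn0.le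
  rw [← hμ0] at hμ
  refine le_trans (le_of_eq ?_) hμ
  have := R.sum
  field_simp
  linarith

lemma isHermitian_outer (u : Coord n → ℝ) : (outer u).IsHermitian := by
  ext k l
  simp [outer, Matrix.vecMulVec_apply, mul_comm]

lemma isHermitian_matB (M α : ℝ) (i j : Idx n) : (matB 1 M α i j).IsHermitian := by
  ext k l
  simp [matB_eq, outer, Matrix.vecMulVec_apply]
  ring

lemma isHermitian_matDual (M α β τ : ℝ) (μ : Option (Fin n) → ℝ) (lam : Idx n → Idx n → ℝ) :
    (matDual 1 M α β τ μ lam).IsHermitian := by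
  have hvar : ∀ k : Option (Fin n), IsSelfAdjoint (matVar k) := by
    intro k
    cases k <;>
      exact (IsSelfAdjoint.all _).smul (isSelfAdjoint_sum _ fun _ _ => isHermitian_outer _)
  refine IsSelfAdjoint.sub (IsSelfAdjoint.sub (IsSelfAdjoint.add ?_ ?_) ?_) ?_
  · exact (IsSelfAdjoint.all _).smul (isHermitian_outer _)
  · exact isSelfAdjoint_sum _ fun k _ => (IsSelfAdjoint.all _).smul (hvar k)
  · exact isSelfAdjoint_sum _ fun k _ => (IsSelfAdjoint.all _).smul (isHermitian_matB _ _ _ _)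
  · exact (IsSelfAdjoint.all _).smul
      (isSelfAdjoint_sum _ fun _ _ => isSelfAdjoint_sum _ fun _ _ => isHermitian_outer _)

/-- The quadratic form is an average over $i$ of forms, each nonnegative once a multiple of the
deviation $h_i$ is subtracted; the coefficient of $h_i$ does not depend on $i$, so these
subtractions sum to zero. -/
lemma DualRelations.posSemidef_matDual (hn : 1 ≤ n) (hv0 : 0 ≤ v) (hv1 : 1 < n → 0 < v)
    (R : DualRelations M n v α β (lamOneStar M n α β) (lamStarOne M n α β)
      (lamZeroOne M n v α β) (lamOneZero M n v α β)) :
    (matDual 1 M α β (tauMul M n v α β) (muMul M n v α β) (lamMul M n v α β)).PosSemidef := by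
  have hN : (1 : ℝ) ≤ n := by exact_mod_cast hn
  have hn0 : (n : ℝ) ≠ 0 := by positivity
  refine Matrix.PosSemidef.of_dotProduct_mulVec_nonneg ?_ fun z => ?_
  · exact isHermitian_matDual _ _ _ _ _ _
  rw [star_trivial, ← gramForm_real, gramForm_matDual _ _ _ _ _ _ _ lamMul_self]
  set g : Fin n → ℝ := fun i => z (Coord.g0 i)
  set G : Fin n → Fin n → ℝ := fun i j => z (Coord.g1 i j)
  set x := z Coord.x0
  set gb := 1 / (n : ℝ) * ∑ t, g t with hgb
  set y : Fin n → ℝ := fun i => 1 / (n : ℝ) * ∑ t, G i t with hy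
  have hC : 1 / (n : ℝ) ^ 2 * ∑ i, ∑ j, ‖x - α • g i - β • G i j‖ ^ 2
      = 1 / (n : ℝ) * ∑ i, ((x - α * g i - β * y i) ^ 2
        + β ^ 2 * (1 / (n : ℝ) * ∑ j, (G i j - y i) ^ 2)) := by
    rw [← Finset.sum_congr rfl fun i _ => mean_sq_sub hn (G i) (x - α * g i) β, ← Finset.mul_sum]
    simp only [Real.norm_eq_abs, sq_abs, smul_eq_mul]
    field_simp
  have hlam : ∑ i, ∑ j, lamMul M n v α β i j *
      interp M (comb z (vx α i) - comb z (vx α j)) (comb z (vgrad i)) (comb z (vgrad j))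
      = ∑ i : Fin n, ((lamOneStar M n α β - lamStarOne M n α β) * interp M (0 - x) 0 gb
      + lamOneStar M n α β * interp M (x - α * g i) (y i) 0
      + lamStarOne M n α β * interp M (0 - (x - α * g i)) 0 (y i)
      + lamZeroOne M n v α β * interp M (x - (x - α * g i)) gb (y i)
      + lamOneZero M n v α β * interp M (x - α * g i - x) (y i) gb) := by
    simp only [sum_idx, lamMul, comb_vx_zero, comb_vx_one, comb_vx_star, comb_vgrad_zero,
      comb_vgrad_one, comb_vgrad_star, Finset.sum_add_distrib, zero_mul, Finset.sum_const_zero,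
      smul_eq_mul, Finset.sum_const, Finset.card_univ, Fintype.card_fin, nsmul_eq_mul, sub_zero]
    ring
  have hvar : ∑ k, muMul M n v α β k * gramVar z k
      = muMul M n v α β none * (1 / (n : ℝ) * ∑ i, (g i - gb) ^ 2)
        + ∑ i, muMul M n v α β (some i) * (1 / (n : ℝ) * ∑ j, (G i j - y i) ^ 2) := by
    simp only [Fintype.sum_option, gramVar, comb_vgrad_zero, comb_vgrad_one, Real.norm_eq_abs,
      sq_abs, smul_eq_mul]
    rfl
  rw [hC, hlam, hvar, Real.norm_eq_abs, sq_abs, tauMul_eq]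
  set μ₀ := muMul M n v α β none with hμ₀
  set V : Fin n → ℝ := fun i => 1 / (n : ℝ) * ∑ j, (G i j - y i) ^ 2 with hV
  have hVi : ∀ i, 1 / (n : ℝ) * ∑ j, (G i j - y i) ^ 2 = V i := fun _ => rfl
  simp only [hVi]
  have hsum0 := sum_sub_mean_eq_zero hn g
  rw [← hgb] at hsum0
  have hred := fun i => R.reduced_form x gb (g i - gb) (y i)
  simp only [add_sub_cancel] at hred
  have hfl := fun i (hi : n = 1 → g i - gb = 0) =>
    R.fluctuation_nonneg hn hv1 (g i - gb) (y i) hi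
  have hs : 0 ≤ lamZeroOne M n v α β + lamOneZero M n v α β := add_nonneg R.p_nonneg R.q_nonneg
  have hW : 0 ≤ ((n : ℝ) - 1) * v := mul_nonneg (by linarith) hv0
  -- For $n=1$ the multiplier is $0$, but so is the variance of a single value.
  have hμV : ∀ i, 0 ≤ (n * muMul M n v α β (some i) - β ^ 2) * V i := by
    intro i
    rcases hn.eq_or_lt with rfl | hn1
    · have : V i = 0 := by
        fin_cases i
        simp [hV, hy]
      simp [this]
    · exact mul_nonneg (sub_nonneg.2 (R.sq_le_muMul hn1 i))
        (mul_nonneg (by positivity) (Finset.sum_nonneg fun j _ => sq_nonneg _))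
  have hg1 : ∀ i, n = 1 → g i - gb = 0 := by
    rintro i rfl
    fin_cases i
    simp [hgb]
  generalize lamZeroOne M n v α β = p at *
  generalize lamOneZero M n v α β = q at *
  generalize lamOneStar M n α β = a at *
  generalize lamStarOne M n α β = b at *
  -- Only the independence of $c_1,c_2$ from $i$ matters from here on.
  generalize 2 * α * (1 - M * n * (a + b)) = c₁ at *
  generalize 2 * α ^ 2 * (n * M * (a + b + p + q) - 1) - 2 * α * n * (p + M * q) = c₂ at *
  have hT : ∀ i, 0 ≤ ((1 - 2 * M * n * a) * x ^ 2 - n * ((a - b) * interp M (0 - x) 0 gb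
      + a * interp M (x - α * g i) (y i) 0 + b * interp M (0 - (x - α * g i)) 0 (y i)
      + p * interp M (x - (x - α * g i)) gb (y i) + q * interp M (x - α * g i - x) (y i) gb)
      - (x - α * g i - β * y i) ^ 2) + μ₀ * (g i - gb) ^ 2
      + (n * muMul M n v α β (some i) - β ^ 2) * V i - (c₁ * x + c₂ * gb) * (g i - gb) := by
    intro i
    rw [hred i]
    have h1 := hfl i (hg1 i)
    have h2 := hμV i
    have h3 : 0 ≤ (n - 1) * v * (p + q) * gb ^ 2 := by positivity
    linarith
  have hsum := mul_nonneg (by positivity : 0 ≤ 1 / (n : ℝ))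
    (Finset.sum_nonneg fun i (_ : i ∈ Finset.univ) => hT i)
  rw [Finset.sum_sub_distrib, ← Finset.mul_sum, hsum0] at hsum
  refine hsum.trans (le_of_eq ?_)
  clear_value V gb y
  simp only [Finset.sum_add_distrib, Finset.sum_sub_distrib, ← Finset.mul_sum, sub_mul, mul_assoc,
    Finset.sum_const, Finset.card_univ, Fintype.card_fin, nsmul_eq_mul]
  field_simp
  ring

end PosSemidef

/-! ### Interpolation inequality for strongly convex smooth functions -/

section Interpolation

variable {d : ℕ}

/-- The descent lemma. -/
lemma le_of_lipschitz_gradient {f : EuclideanSpace ℝ (Fin d) → ℝ} {M : ℝ}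
    (hf : Differentiable ℝ f) (hL : ∀ x y, ‖gradient f x - gradient f y‖ ≤ M * ‖x - y‖)
    (x y : EuclideanSpace ℝ (Fin d)) :
    f y ≤ f x + inner ℝ (gradient f x) (y - x) + M / 2 * ‖y - x‖ ^ 2 := by
  set w := y - x with hw
  -- The error of the quadratic upper model along the segment; the Lipschitz bound makes its
  -- derivative nonpositive on $(0,1)$.
  let φ : ℝ → ℝ := fun t => f (x + t • w) - t * inner ℝ (gradient f x) w - M / 2 * t ^ 2 * ‖w‖ ^ 2
  have hφ : ∀ t, HasDerivAt φ
      (inner ℝ (gradient f (x + t • w)) w - inner ℝ (gradient f x) w - M * t * ‖w‖ ^ 2) t := by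
    intro t
    have h1 : HasDerivAt (fun t : ℝ => x + t • w) w t := by
      simpa using ((hasDerivAt_id t).smul_const w).const_add x
    have h2 := ((hf (x + t • w)).hasGradientAt.hasFDerivAt).comp_hasDerivAt t h1
    have h3 := (hasDerivAt_id t).mul_const (inner ℝ (gradient f x) w)
    have h4 := (((hasDerivAt_id t).pow 2).const_mul (M / 2)).mul_const (‖w‖ ^ 2)
    refine ((h2.sub h3).sub h4).congr_deriv ?_
    rw [InnerProductSpace.toDual_apply_apply, id]
    push_cast
    ring
  have hanti : AntitoneOn φ (Set.Icc 0 1) := by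
    apply antitoneOn_of_deriv_nonpos (convex_Icc 0 1)
      (fun t _ => (hφ t).continuousAt.continuousWithinAt)
      (fun t _ => (hφ t).differentiableAt.differentiableWithinAt)
    intro t ht
    rw [interior_Icc] at ht
    rw [(hφ t).deriv]
    have h1 : inner ℝ (gradient f (x + t • w)) w - inner ℝ (gradient f x) w
        ≤ ‖gradient f (x + t • w) - gradient f x‖ * ‖w‖ := by
      rw [← inner_sub_left]
      exact real_inner_le_norm _ _
    have h2 := hL (x + t • w) x
    rw [add_sub_cancel_left, norm_smul, Real.norm_eq_abs, abs_of_pos ht.1] at h2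
    nlinarith [mul_le_mul_of_nonneg_right h2 (norm_nonneg w)]
  have := hanti (Set.left_mem_Icc.2 zero_le_one) (Set.right_mem_Icc.2 zero_le_one) zero_le_one
  simp only [φ, one_smul, zero_smul, hw, add_sub_cancel, add_zero] at this
  linarith

/-- The interpolation inequality for `1`-strongly convex, `M`-smooth functions. -/
lemma StronglyConvexSmooth.interpolation {f : EuclideanSpace ℝ (Fin d) → ℝ} {M : ℝ}
    (hf : StronglyConvexSmooth 1 M f) (hM : 1 < M) (x y : EuclideanSpace ℝ (Fin d)) :
    -(2 * (M - 1) * (f x - f y)) ≤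
      -M * ‖x - y‖ ^ 2 + 2 * inner ℝ (x - y) (gradient f x - M • gradient f y)
        - ‖gradient f x - gradient f y‖ ^ 2 := by
  have hM' : 0 < M - 1 := by linarith
  have h1 := fun z => hf.strong_convexity y z
  have h2 := fun z => le_of_lipschitz_gradient hf.differentiable hf.lipschitz_gradient x z
  generalize gradient f x = gx at *
  generalize gradient f y = gy at *
  have hk : (M - 1)⁻¹ * (M - 1) = 1 := inv_mul_cancel₀ hM'.ne'
  generalize (M - 1)⁻¹ = k at *
  -- The lower quadratic model at $y$ and the upper one at $x$ are compared at the point minimizing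
  -- upper minus lower, where the comparison is sharpest.
  have h3 := (h1 (x - k • ((gx - gy) - (x - y)))).trans (h2 _)
  have e1 : x - k • ((gx - gy) - (x - y)) - y = (x - y) - k • ((gx - gy) - (x - y)) := by abel
  have e2 : x - k • ((gx - gy) - (x - y)) - x = -(k • ((gx - gy) - (x - y))) := by abel
  rw [e1, e2] at h3
  generalize x - y = w at *
  simp only [← real_inner_self_eq_norm_sq, inner_sub_left, inner_sub_right, inner_neg_left,
    inner_neg_right, inner_smul_left, inner_smul_right, RCLike.conj_to_real] at h3 ⊢
  rw [real_inner_comm gx gy, real_inner_comm gx w, real_inner_comm gy w] at *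
  have h4 := mul_le_mul_of_nonneg_left h3 (by linarith : 0 ≤ 2 * (M - 1))
  linear_combination h4 + (k * (M - 1) - 1) * (inner ℝ gx gx + inner ℝ gy gy + inner ℝ w w
    - 2 * inner ℝ gx gy - 2 * inner ℝ gx w + 2 * inner ℝ gy w) * hk

end Interpolation

/-! ### Weak duality: from the certificate to the bound -/

section PerformanceBound

variable {M : ℝ} {n : ℕ} {v α β : ℝ}

lemma lamMul_nonneg (hn : 1 ≤ n)
    (R : DualRelations M n v α β (lamOneStar M n α β) (lamStarOne M n α β)
      (lamZeroOne M n v α β) (lamOneZero M n v α β)) (i j : Idx n) :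
    0 ≤ lamMul M n v α β i j := by
  cases i <;> cases j <;>
    simp only [lamMul, le_refl, R.a_nonneg, R.b_nonneg, R.p_nonneg, R.q_nonneg]
  exact mul_nonneg (by positivity) (sub_nonneg.2 R.le)

lemma muMul_nonneg (k : Option (Fin n)) : 0 ≤ muMul M n v α β k := by
  cases k <;> simp only [muMul] <;> split_ifs <;> simp

/-- Balance at $1^{(k)}$ and at $0$ is the relation $p-q=a-b$; at $*$ it is built into
$\lambda_{*,0}=n(a-b)$. -/
lemma sum_lamMul_eq (R : DualRelations M n v α β (lamOneStar M n α β) (lamStarOne M n α β)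
      (lamZeroOne M n v α β) (lamOneZero M n v α β)) (j : Idx n) :
    ∑ i, lamMul M n v α β i j = ∑ i, lamMul M n v α β j i := by
  have := R.diff
  cases j <;> simp [sum_idx, lamMul]
  · linear_combination -(n : ℝ) * this
  · linear_combination this
  · ring

/-- A circulation pairs to zero with a potential difference; this removes the unknown function
values. -/
lemma sum_mul_sub_eq_zero {ι : Type*} [Fintype ι] {lam : ι → ι → ℝ}
    (h : ∀ j, ∑ i, lam i j = ∑ i, lam j i) (F : ι → ℝ) :
    ∑ i, ∑ j, lam i j * (F i - F j) = 0 := by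
  simp only [mul_sub, Finset.sum_sub_distrib]
  rw [sub_eq_zero, Finset.sum_comm (f := fun i j => lam i j * F j)]
  simp only [← Finset.sum_mul, h]

/-- The performance bound for `n` stochastic gradients `γ i` at `x₀` and `n` stochastic gradients
`γ' i j` at each of the points `x₀ - α • γ i`. -/
lemma mean_sq_dist_le {d : ℕ} {f : EuclideanSpace ℝ (Fin d) → ℝ} (hf : StronglyConvexSmooth 1 M f)
    (hM : 1 < M) (hn : 1 ≤ n) (hv0 : 0 ≤ v) (hv1 : 1 < n → 0 < v)
    (Rel : DualRelations M n v α β (lamOneStar M n α β) (lamStarOne M n α β)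
      (lamZeroOne M n v α β) (lamOneZero M n v α β))
    {R σ : ℝ} {x₀ xs : EuclideanSpace ℝ (Fin d)} (hxs : gradient f xs = 0)
    (hR : ‖x₀ - xs‖ ^ 2 ≤ R ^ 2)
    (γ : Fin n → EuclideanSpace ℝ (Fin d)) (γ' : Fin n → Fin n → EuclideanSpace ℝ (Fin d))
    (hγ : (1 / (n : ℝ)) • ∑ i, γ i = gradient f x₀)
    (hγ' : ∀ i, (1 / (n : ℝ)) • ∑ j, γ' i j = gradient f (x₀ - α • γ i))
    (hσ : 1 / (n : ℝ) * ∑ i, ‖γ i - gradient f x₀‖ ^ 2 ≤ σ ^ 2)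
    (hσ' : ∀ i, 1 / (n : ℝ) * ∑ j, ‖γ' i j - gradient f (x₀ - α • γ i)‖ ^ 2 ≤ σ ^ 2) :
    1 / (n : ℝ) * ∑ i, 1 / (n : ℝ) * ∑ j, ‖x₀ - α • γ i - β • γ' i j - xs‖ ^ 2
      ≤ tauMul M n v α β * R ^ 2 + ∑ k : Option (Fin n), muMul M n v α β k * σ ^ 2 := by
  -- Points are measured from `xs`, in accordance with $\bar x_*=0$.
  let Z : Coord n → EuclideanSpace ℝ (Fin d) := fun
    | Coord.x0 => x₀ - xs
    | Coord.g0 i => γ i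
    | Coord.g1 i j => γ' i j
  let pt : Idx n → EuclideanSpace ℝ (Fin d) := fun
    | Idx.zero => x₀
    | Idx.one i => x₀ - α • γ i
    | Idx.star => xs
  have hpt : ∀ i, comb Z (vx α i) = pt i - xs := by
    rintro (_ | i | _)
    · exact comb_vx_zero Z α
    · rw [comb_vx_one]
      simp only [Z, pt]
      abel
    · rw [comb_vx_star]
      simp [pt]
  have hgrad : ∀ i, comb Z (vgrad i) = gradient f (pt i) := by
    rintro (_ | i | _)
    · rw [comb_vgrad_zero]
      exact hγ
    · rw [comb_vgrad_one]
      exact hγ' i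
    · rw [comb_vgrad_star]
      exact hxs.symm
  have hpos := gramForm_nonneg (Rel.posSemidef_matDual hn hv0 hv1) Z
  rw [gramForm_matDual _ _ _ _ _ _ _ lamMul_self] at hpos
  have hB : 0 ≤ ∑ i, ∑ j, lamMul M n v α β i j *
      interp M (comb Z (vx α i) - comb Z (vx α j)) (comb Z (vgrad i)) (comb Z (vgrad j)) := by
    have h0 : ∑ i, ∑ j, lamMul M n v α β i j *
        (-(2 * (M - 1)) * f (pt i) - -(2 * (M - 1)) * f (pt j)) = 0 :=
      sum_mul_sub_eq_zero (sum_lamMul_eq Rel) _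
    rw [← h0]
    refine Finset.sum_le_sum fun i _ => Finset.sum_le_sum fun j _ =>
      mul_le_mul_of_nonneg_left ?_ (lamMul_nonneg hn Rel i j)
    rw [hpt, hpt, hgrad, hgrad, sub_sub_sub_cancel_right]
    refine le_trans (le_of_eq ?_) (hf.interpolation hM (pt i) (pt j))
    ring
  have hτ : tauMul M n v α β * ‖Z Coord.x0‖ ^ 2 ≤ tauMul M n v α β * R ^ 2 := by
    refine mul_le_mul_of_nonneg_left hR ?_
    rw [tauMul_eq]
    linarith [Rel.two_mul_le]
  have hμ : ∑ k, muMul M n v α β k * gramVar Z k ≤ ∑ k, muMul M n v α β k * σ ^ 2 := by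
    refine Finset.sum_le_sum fun k _ => mul_le_mul_of_nonneg_left ?_ (muMul_nonneg k)
    cases k with
    | none =>
      simp only [gramVar, hgrad]
      exact hσ
    | some i =>
      simp only [gramVar, hgrad]
      exact hσ' i
  have hobj : 1 / (n : ℝ) * ∑ i, 1 / (n : ℝ) * ∑ j, ‖x₀ - α • γ i - β • γ' i j - xs‖ ^ 2
      = 1 / (n : ℝ) ^ 2 * ∑ i, ∑ j,
          ‖Z Coord.x0 - α • Z (Coord.g0 i) - β • Z (Coord.g1 i j)‖ ^ 2 := by
    rw [← Finset.mul_sum, ← mul_assoc, one_div_mul_one_div, ← pow_two]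
    congr 1
    refine Finset.sum_congr rfl fun i _ => Finset.sum_congr rfl fun j _ => ?_
    congr 2
    simp only [Z]
    abel
  rw [hobj]
  linarith

end PerformanceBound

/-! ### Expectations over finitely many equiprobable values -/

section Probability

variable {n : ℕ} {E F : Type*} [NormedAddCommGroup E] [MeasurableSpace E] [BorelSpace E]
  [NormedAddCommGroup F]

/-- A finite sum of Dirac masses integrates every function, measurable or not; $n\ne0$ keeps the
weight $1/n$ finite. -/
lemma integrable_uniform (γ : Fin n → E) (hn : n ≠ 0) (φ : E → F) :
    Integrable φ ((n : ℝ≥0∞)⁻¹ • ∑ i, Measure.dirac (γ i)) := by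
  refine Integrable.smul_measure ?_ (by simpa using hn)
  rw [integrable_finsetSum_measure]
  exact fun i _ => integrable_dirac (by simp)

lemma integral_uniform [NormedSpace ℝ F] [CompleteSpace F] (γ : Fin n → E) (φ : E → F) :
    ∫ y, φ y ∂((n : ℝ≥0∞)⁻¹ • ∑ i, Measure.dirac (γ i)) = (1 / (n : ℝ)) • ∑ i, φ (γ i) := by
  rw [integral_smul_measure, integral_finsetSum_measure fun i _ => integrable_dirac (by simp)]
  simp

variable {Ξ Ω : Type*} [MeasurableSpace Ξ] [MeasurableSpace Ω]

/-- If `G` takes finitely many values and is independent of `ξ`, then `ψ (G ω) (ξ ω)` can be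
integrated by conditioning on `G`, without joint measurability of `ψ`. -/
lemma integral_comp_of_indepFun {P : Measure Ξ} {Pr : Measure Ω} [IsProbabilityMeasure P]
    [IsProbabilityMeasure Pr] (hn : n ≠ 0)
    {G : Ω → E} {ξ : Ω → Ξ} (hG : AEMeasurable G Pr) (hξ : HasLaw ξ P Pr) (hind : IndepFun G ξ Pr)
    (γ : Fin n → E) (hlaw : Pr.map G = (n : ℝ≥0∞)⁻¹ • ∑ i, Measure.dirac (γ i))
    (ψ : E → Ξ → ℝ) (hψ : ∀ y, Integrable (ψ y) P) (hψm : ∀ y, Measurable (ψ y)) :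
    Integrable (fun ω => ψ (G ω) (ξ ω)) Pr ∧
      ∫ ω, ψ (G ω) (ξ ω) ∂Pr = 1 / (n : ℝ) * ∑ i, ∫ z, ψ (γ i) z ∂P := by
  classical
  let T : Finset E := Finset.univ.image γ
  have hmem : ∀ᵐ ω ∂Pr, G ω ∈ T := by
    have : ∀ᵐ y ∂(Pr.map G), y ∈ T := by
      rw [hlaw]
      rw [ae_iff, Measure.smul_apply, Measure.finsetSum_apply]
      simp [T]
    exact ae_of_ae_map hG this
  -- Splitting by the value of $G$ gives products of a function of $G$ and a function of $\xi$, to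
  -- which independence applies. The set `T` counts each value once; multiplicities return through
  -- the law of $G$.
  have hae : (fun ω => ψ (G ω) (ξ ω)) =ᵐ[Pr]
      fun ω => ∑ y ∈ T, ({y} : Set E).indicator (fun _ => (1 : ℝ)) (G ω) * ψ y (ξ ω) := by
    filter_upwards [hmem] with ω hω
    rw [Finset.sum_eq_single_of_mem _ hω]
    · simp
    · intro y _ hy
      simp [hy.symm]
  have hmeas : ∀ y : E, Measurable (({y} : Set E).indicator fun _ => (1 : ℝ)) :=
    fun y => measurable_const.indicator (measurableSet_singleton y)
  have hindy : ∀ y, IndepFun (fun ω => ({y} : Set E).indicator (fun _ => (1 : ℝ)) (G ω))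
      (fun ω => ψ y (ξ ω)) Pr := fun y => hind.comp (hmeas y) (hψm y)
  have h1 : ∀ y, Integrable (fun ω => ({y} : Set E).indicator (fun _ => (1 : ℝ)) (G ω)) Pr := by
    intro y
    have := integrable_uniform γ hn (({y} : Set E).indicator fun _ => (1 : ℝ))
    rw [← hlaw] at this
    exact this.comp_aemeasurable hG
  have h2 : ∀ y, Integrable (fun ω => ψ y (ξ ω)) Pr := by
    intro y
    have := hψ y
    rw [← hξ.map_eq] at this
    exact this.comp_aemeasurable hξ.aemeasurable
  have h3 : ∀ y, Integrable
      (fun ω => ({y} : Set E).indicator (fun _ => (1 : ℝ)) (G ω) * ψ y (ξ ω)) Pr :=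
    fun y => (hindy y).integrable_mul (h1 y) (h2 y)
  refine ⟨(integrable_finsetSum T fun y _ => h3 y).congr hae.symm, ?_⟩
  have h4 : ∀ y, ∫ ω, ({y} : Set E).indicator (fun _ => (1 : ℝ)) (G ω) * ψ y (ξ ω) ∂Pr
      = 1 / (n : ℝ) * ∑ i, if y = γ i then ∫ z, ψ (γ i) z ∂P else 0 := by
    intro y
    have e1 : ∫ ω, ({y} : Set E).indicator (fun _ => (1 : ℝ)) (G ω) ∂Pr
        = (1 / (n : ℝ)) * ∑ i, ({y} : Set E).indicator (fun _ => (1 : ℝ)) (γ i) := by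
      rw [← smul_eq_mul, ← integral_uniform, ← hlaw,
        integral_map hG (hmeas y).aestronglyMeasurable]
    have e2 : ∫ ω, ψ y (ξ ω) ∂Pr = ∫ z, ψ y z ∂P :=
      hξ.integral_comp (hψm y).aestronglyMeasurable
    rw [(hindy y).integral_fun_mul_eq_mul_integral (h1 y).aestronglyMeasurable
      (h2 y).aestronglyMeasurable, e1, e2, mul_assoc, Finset.sum_mul]
    congr 1
    refine Finset.sum_congr rfl fun i _ => ?_
    by_cases h : y = γ i
    · simp [h]
    · simp [h, Ne.symm h]
  rw [integral_congr_ae hae, integral_finsetSum _ fun y _ => h3 y, Finset.sum_congr rfl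
    fun y _ => h4 y, ← Finset.mul_sum, Finset.sum_comm]
  congr 1
  refine Finset.sum_congr rfl fun i _ => ?_
  rw [Finset.sum_ite_eq', if_pos (Finset.mem_image_of_mem γ (Finset.mem_univ i))]

/-- Expectations of functions of a stochastic gradient are averages over its `n` values. -/
lemma integral_comp_eq_mean [NormedSpace ℝ F] [CompleteSpace F] {P : Measure Ξ} (hn : n ≠ 0)
    {G : Ξ → E} (hG : Measurable G) {γ : Fin n → E}
    (hlaw : P.map G = (n : ℝ≥0∞)⁻¹ • ∑ i, Measure.dirac (γ i)) {φ : E → F}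
    (hφ : StronglyMeasurable φ) :
    Integrable (fun z => φ (G z)) P ∧ ∫ z, φ (G z) ∂P = (1 / (n : ℝ)) • ∑ i, φ (γ i) := by
  constructor
  · have := integrable_uniform γ hn φ
    rw [← hlaw] at this
    exact this.comp_measurable hG
  · rw [← integral_uniform, ← hlaw, integral_map hG.aemeasurable hφ.aestronglyMeasurable]

end Probability

end TwoStepSG

/-! ### The main theorem -/

open TwoStepSG
theorem theorem2 (M : ℝ) (hM : 1 < M) (n : ℕ) (hn : 1 ≤ n) (v : ℝ) (hv0 : 0 ≤ v)
    (hv : ((n : ℝ) - 1) * M * v ≤ (M - 1) * n)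
    (α β : ℝ) (hαβ : IsSchedule M n v α β) :
    -- (i) the multipliers are nonnegative
    ((∀ i j : Idx n, i ≠ j → 0 ≤ lamMul M n v α β i j) ∧
      0 ≤ tauMul M n v α β ∧
      ∀ k : Option (Fin n), 0 ≤ muMul M n v α β k) ∧
    -- (ii) the constraints of the dual problem hold
    ((∀ j : Idx n, ∑ i ∈ Finset.univ.erase j, lamMul M n v α β i j =
        ∑ i ∈ Finset.univ.erase j, lamMul M n v α β j i) ∧
      ((1 < n → 0 < v) →
        (matDual 1 M α β (tauMul M n v α β) (muMul M n v α β) (lamMul M n v α β)).PosSemidef)) ∧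
    -- (iii) the performance bound of the two-step stochastic gradient method
    ((1 < n → 0 < v) →
      ∀ (R σ : ℝ), 0 < R → 0 < σ →
      ∀ (d : ℕ) (f : EuclideanSpace ℝ (Fin d) → ℝ), StronglyConvexSmooth 1 M f →
      ∀ (Ξ : Type*) [MeasurableSpace Ξ] (P : Measure Ξ) [IsProbabilityMeasure P]
        (g : EuclideanSpace ℝ (Fin d) → Ξ → EuclideanSpace ℝ (Fin d)),
        IsStochasticGradient P f g n σ →
      ∀ (Ω : Type*) [MeasurableSpace Ω] (Pr : Measure Ω) [IsProbabilityMeasure Pr]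
        (ξ₀ ξ₁ : Ω → Ξ), HasLaw ξ₀ P Pr → HasLaw ξ₁ P Pr → IndepFun ξ₀ ξ₁ Pr →
      ∀ x₀ xs : EuclideanSpace ℝ (Fin d), gradient f xs = 0 → ‖x₀ - xs‖ ^ 2 ≤ R ^ 2 →
      ∀ x₁ x₂ : Ω → EuclideanSpace ℝ (Fin d),
        (∀ ω, x₁ ω = sgStep g α x₀ (ξ₀ ω)) → (∀ ω, x₂ ω = sgStep g β (x₁ ω) (ξ₁ ω)) →
        Integrable (fun ω => ‖x₂ ω - xs‖ ^ 2) Pr ∧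
        ∫ ω, ‖x₂ ω - xs‖ ^ 2 ∂Pr ≤
          tauMul M n v α β * R ^ 2 + ∑ k : Option (Fin n), muMul M n v α β k * σ ^ 2) := by
  have R := hαβ.dualRelations hM hn hv0 hv
  have hn0 : n ≠ 0 := by omega
  refine ⟨⟨fun i j _ => lamMul_nonneg hn R i j, ?_, muMul_nonneg⟩,
    ⟨fun j => ?_, fun hv1 => R.posSemidef_matDual hn hv0 hv1⟩, ?_⟩
  · rw [tauMul_eq]
    linarith [R.two_mul_le]
  -- The diagonal multipliers are zero, so the excluded index may be put back.
  · rw [Finset.sum_erase (f := fun i => lamMul M n v α β i j) _ (lamMul_self j),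
      Finset.sum_erase _ (lamMul_self j)]
    exact sum_lamMul_eq R j
  intro hv1 r σ _ _ d f hf Ξ _ P _ g hg Ω _ Pr _ ξ₀ ξ₁ hξ₀ hξ₁ hind x₀ xs hxs hr x₁ x₂ hx₁ hx₂
  choose Γ hΓ using hg.equiprobable
  have hmean : ∀ x, (1 / (n : ℝ)) • ∑ i, Γ x i = gradient f x := fun x => by
    rw [← hg.unbiased, (integral_comp_eq_mean hn0 (hg.measurable x) (hΓ x)
      (φ := fun y => y) stronglyMeasurable_id).2]
  have hvar : ∀ x, 1 / (n : ℝ) * ∑ i, ‖Γ x i - gradient f x‖ ^ 2 ≤ σ ^ 2 := fun x => by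
    refine le_trans (le_of_eq ?_) (hg.variance_le x)
    rw [(integral_comp_eq_mean hn0 (hg.measurable x) (hΓ x)
      (φ := fun y => ‖y - gradient f x‖ ^ 2) (Continuous.stronglyMeasurable (by fun_prop))).2,
      smul_eq_mul]
  have hdist := fun y => integral_comp_eq_mean hn0 (hg.measurable (x₀ - α • y)) (hΓ (x₀ - α • y))
    (φ := fun z => ‖x₀ - α • y - β • z - xs‖ ^ 2) (Continuous.stronglyMeasurable (by fun_prop))
  have hG : Pr.map (fun ω => g x₀ (ξ₀ ω)) = (n : ℝ≥0∞)⁻¹ • ∑ i, Measure.dirac (Γ x₀ i) := by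
    rw [← hΓ x₀, ← hξ₀.map_eq,
      AEMeasurable.map_map_of_aemeasurable (hg.measurable x₀).aemeasurable hξ₀.aemeasurable]
    rfl
  have hx : ∀ ω, ‖x₂ ω - xs‖ ^ 2
      = ‖x₀ - α • g x₀ (ξ₀ ω) - β • g (x₀ - α • g x₀ (ξ₀ ω)) (ξ₁ ω) - xs‖ ^ 2 := fun ω => by
    rw [hx₂, hx₁]
    rfl
  -- Conditioning on the first gradient, which takes the values `Γ x₀ i`, leaves for each $i$ an
  -- expectation over the second sample; `hdist` turns it into an average over the values at
  -- $x_0-\alpha\,\Gamma_{x_0,i}$.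
  obtain ⟨hint, heq⟩ := integral_comp_of_indepFun hn0
    ((hg.measurable x₀).comp_aemeasurable hξ₀.aemeasurable) hξ₁
    (hind.comp (hg.measurable x₀) measurable_id) (Γ x₀) hG
    (fun y z => ‖x₀ - α • y - β • g (x₀ - α • y) z - xs‖ ^ 2) (fun y => (hdist y).1)
    (fun y => by have := hg.measurable (x₀ - α • y); fun_prop)
  simp only [hx]
  refine ⟨hint, ?_⟩
  refine heq.trans_le ?_
  simp only [fun y => (hdist y).2, smul_eq_mul]
  exact mean_sq_dist_le hf hM hn hv0 hv1 R hxs hr (Γ x₀) (fun i => Γ (x₀ - α • Γ x₀ i)) (hmean x₀)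
    (fun i => hmean _) (hvar x₀) (fun i => hvar _)
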